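/- Let $M$ be a smooth manifold of dimension $2n+1$ with an almost contact metric structure $(\varphi,\xi,\eta,g)$: $\varphi$ is a smooth $(1,1)$-tensor field, $\xi$ a smooth vector field, $\eta$ a smooth 1-form and $g$ a Riemannian metric with $$\varphi^2=-\mathrm{id}+\eta\otimes\xi,\quad \varphi(\xi)=0,\quad \eta\circ\varphi=0,\quad g(\xi,\xi)=1,\quad g(\varphi x,\varphi y)=g(x,y)-\eta(x)\eta(y).$$ Let $\nabla$ be the Levi-Civita connection of $g$ and put $h=-\varphi^2$. For a bilinear form $L$ on a tangent space $T_pM$ put $$SL(x,y)=\tfrac12[L(x,y)+L(y,x)],\quad AL(x,y)=\tfrac12[L(x,y)-L(y,x)],\quad hL(x,y)=L(hx,hy),$$ $$vL(x,y)=\eta(x)L(\xi,y)+\eta(y)L(x,\xi)-2\eta(x)\eta(y)L(\xi,\xi),\quad wL(x,y)=\eta(x)\eta(y)L(\xi,\xi),\quad (L\circ\varphi)(x,y)=L(\varphi x,\varphi y),$$ and let $\alpha=\sum_{i,j} g(e^i,e^j)\,hL(e_i,e_j)$ and $\beta=\sum_{i,j} g(e^i,e^j)\,hL(e_i,\varphi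 e_j)$, where $(e_i)$ is any basis of $T_pM$ and $(e^i)$ is its dual basis. Define $$L_1(L)=\tfrac{\alpha}{2n}\,hg,\quad L_2(L)=\tfrac12[ShL+ShL\circ\varphi]-L_1(L),\quad L_3(L)=\tfrac12[ShL-ShL\circ\varphi],$$ $$L_4(L)(x,y)=-\tfrac{\beta}{2n}\,hg(x,\varphi y),\quad L_5(L)=\tfrac12[AhL+AhL\circ\varphi]-L_4(L),\quad L_6(L)=\tfrac12[AhL-AhL\circ\varphi],$$ $$L_7(L)=SvL,\quad L_8(L)=AvL,\quad L_9(L)=wL$$ (with $L_1=L_4=0$ if $n=0$), and let $\mathcal L_i=\{L: L=L_i(L)\}$ for $i=1,\dots,9$. For a set $I$ of indices let $\bigoplus_{i\in I}\Omega_i$ denote the space of smooth 1-forms $\theta$ on $M$ such that at every point $p$ the bilinear form $(\nabla\theta)_p$, $(\nabla\theta)(x,y)=(\nabla_x\theta)(y)$, lies in $\bigoplus_{i\in I}\mathcal L_i$. Let $\theta$ be a smooth 1-form on $M$, and let $\theta^*$ be its dual vector field, $g(\theta^*,y)=\theta(y)$. Then (i) $\theta$ is closed if and only if $\theta\in\Omega_1\oplus\Omega_2\oplus\Omega_3\oplus\Omega_7\oplus\Omega_9$;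 (ii) $\theta^*$ is a Killing vector field if and only if $\theta\in\Omega_4\oplus\Omega_5\oplus\Omega_6\oplus\Omega_8$. -/

import Mathlib

open scoped Manifold ContDiff
open Bundle

section AlmostContactMetricAlgebra

/-- An almost contact metric structure `(φ, ξ, η, g)` on a real vector space `V` of dimension
`2n + 1`. -/
structure AlmostContactMetricSpace (n : ℕ) (V : Type*) [AddCommGroup V] [Module ℝ V] where
  finrank_eq : Module.finrank ℝ V = 2 * n + 1
  /-- the tensor of type (1,1) -/
  φ : V →ₗ[ℝ] V
  /-- the characteristic vector -/
  ξ : V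
  /-- the characteristic covector -/
  η : V →ₗ[ℝ] ℝ
  /-- the metric -/
  g : V →ₗ[ℝ] V →ₗ[ℝ] ℝ
  g_symm : ∀ x y, g x y = g y x
  g_pos : ∀ x, x ≠ 0 → 0 < g x x
  φ_sq : ∀ x, φ (φ x) = -x + η x • ξ
  φ_ξ : φ ξ = 0
  g_ξ : g ξ ξ = 1
  g_φ : ∀ x y, g (φ x) (φ y) = g x y - η x * η y

namespace AlmostContactMetricSpace

variable {n : ℕ} {V : Type*} [AddCommGroup V] [Module ℝ V] (A : AlmostContactMetricSpace n V)

theorem finiteDimensional (A : AlmostContactMetricSpace n V) : FiniteDimensional ℝ V :=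
  Module.finite_of_finrank_pos (by rw [A.finrank_eq]; omega)

/-- The isomorphism `V ≃ V*`, `v ↦ g(v, ·)`. -/
noncomputable def flat : V ≃ₗ[ℝ] Module.Dual ℝ V :=
  haveI := A.finiteDimensional
  LinearEquiv.ofInjectiveOfFinrankEq A.g
    ((injective_iff_map_eq_zero _).2 fun v hv => by
      by_contra h
      have h1 := A.g_pos v h
      rw [hv] at h1
      exact lt_irrefl _ h1)
    Subspace.dual_finrank_eq.symm

theorem flat_apply (x y : V) : A.flat x y = A.g x y := rfl

theorem g_flat_symm (a : Module.Dual ℝ V) (y : V) : A.g (A.flat.symm a) y = a y := by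
  rw [← A.flat_apply, LinearEquiv.apply_symm_apply]

/-- The trace of a tensor `B` of type (0,2) with respect to the metric: the trace of the
endomorphism `T` with `g(T x, y) = B(x, y)`. -/
noncomputable def metricTrace (B : V →ₗ[ℝ] V →ₗ[ℝ] ℝ) : ℝ :=
  LinearMap.trace ℝ V (A.flat.symm.toLinearMap ∘ₗ B)

/-- In terms of an arbitrary basis `e_i` of `V` with dual basis `e^i`, the metric trace is
`∑ g(e^i, e^j) B(e_i, e_j)`, for the metric induced on `V*`. -/
theorem metricTrace_eq_sum {ι : Type*} [Fintype ι] (e : Module.Basis ι ℝ V)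
    (B : V →ₗ[ℝ] V →ₗ[ℝ] ℝ) :
    A.metricTrace B
      = ∑ i, ∑ j, A.g (A.flat.symm (e.coord i)) (A.flat.symm (e.coord j)) * B (e i) (e j) := by
  classical
  rw [metricTrace, LinearMap.trace_eq_matrix_trace ℝ e, Matrix.trace]
  refine Finset.sum_congr rfl fun i _ => ?_
  rw [Matrix.diag_apply, LinearMap.toMatrix_apply]
  have hB : B (e i) = ∑ j, B (e i) (e j) • e.coord j := by
    refine e.ext fun k => ?_
    simp
  have key : (e.repr ((A.flat.symm.toLinearMap ∘ₗ B) (e i))) i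
      = A.g (A.flat.symm (e.coord i)) (A.flat.symm (B (e i))) := by
    rw [A.g_flat_symm]; rfl
  rw [key]
  have h2 := congrArg (fun a => A.g (A.flat.symm (e.coord i)) (A.flat.symm a)) hB
  simp only [map_sum, map_smul, smul_eq_mul] at h2
  rw [h2]
  exact Finset.sum_congr rfl fun j _ => mul_comm _ _

/-- The operator `h = -φ²` on `V`. -/
def hEnd : V →ₗ[ℝ] V := -(A.φ ∘ₗ A.φ)

/-- The operator `S` (symmetrization) on tensors of type (0,2). -/
noncomputable def opS (L : V →ₗ[ℝ] V →ₗ[ℝ] ℝ) : V →ₗ[ℝ] V →ₗ[ℝ] ℝ := (1 / 2 : ℝ) • (L + L.flip)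

/-- The operator `A` (antisymmetrization) on tensors of type (0,2). -/
noncomputable def opA (L : V →ₗ[ℝ] V →ₗ[ℝ] ℝ) : V →ₗ[ℝ] V →ₗ[ℝ] ℝ := (1 / 2 : ℝ) • (L - L.flip)

/-- The operator `h` on tensors: `hL(x, y) = L(hx, hy)`. -/
def opH (L : V →ₗ[ℝ] V →ₗ[ℝ] ℝ) : V →ₗ[ℝ] V →ₗ[ℝ] ℝ := L.compl₁₂ A.hEnd A.hEnd

/-- The operator `v` on tensors:
`vL(x, y) = η(x) L(ξ, y) + η(y) L(x, ξ) - 2 η(x) η(y) L(ξ, ξ)`. -/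
noncomputable def opV (L : V →ₗ[ℝ] V →ₗ[ℝ] ℝ) : V →ₗ[ℝ] V →ₗ[ℝ] ℝ :=
  A.η.smulRight (L A.ξ) + (L.flip A.ξ).smulRight A.η
    - (2 * L A.ξ A.ξ) • A.η.smulRight A.η

/-- The operator `w` on tensors: `wL(x, y) = η(x) η(y) L(ξ, ξ)`. -/
noncomputable def opW (L : V →ₗ[ℝ] V →ₗ[ℝ] ℝ) : V →ₗ[ℝ] V →ₗ[ℝ] ℝ :=
  (L A.ξ A.ξ) • A.η.smulRight A.η

/-- `L ∘ φ`, that is `(x, y) ↦ L(φx, φy)`. -/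
def opPhi (L : V →ₗ[ℝ] V →ₗ[ℝ] ℝ) : V →ₗ[ℝ] V →ₗ[ℝ] ℝ := L.compl₁₂ A.φ A.φ

/-- The trace `α = g(e^i, e^j) hL(e_i, e_j)`. -/
noncomputable def traceα (L : V →ₗ[ℝ] V →ₗ[ℝ] ℝ) : ℝ := A.metricTrace (A.opH L)

/-- The trace `β = g(e^i, e^j) hL(e_i, φ e_j)`. -/
noncomputable def traceβ (L : V →ₗ[ℝ] V →ₗ[ℝ] ℝ) : ℝ := A.metricTrace ((A.opH L).compl₂ A.φ)

/-- The tensors `L_1(L), …, L_9(L)` associated with a tensor `L` of type (0,2) (the value at an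
index `i ∉ {1, …, 9}` is irrelevant and set to `0`). The factors `1/(2n)` and `-1/(2n)` make `L_1`
and `L_4` the orthogonal projections onto the lines spanned by `hg` and by `(x, y) ↦ g(x, φy)`. -/
noncomputable def component (i : ℕ) (L : V →ₗ[ℝ] V →ₗ[ℝ] ℝ) : V →ₗ[ℝ] V →ₗ[ℝ] ℝ :=
  match i with
  | 1 => (A.traceα L / (2 * n)) • A.opH A.g
  | 2 => (1 / 2 : ℝ) • (opS (A.opH L) + A.opPhi (opS (A.opH L)))
          - (A.traceα L / (2 * n)) • A.opH A.g
  | 3 => (1 / 2 : ℝ) • (opS (A.opH L) - A.opPhi (opS (A.opH L)))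
  | 4 => (-A.traceβ L / (2 * n)) • (A.opH A.g).compl₂ A.φ
  | 5 => (1 / 2 : ℝ) • (opA (A.opH L) + A.opPhi (opA (A.opH L)))
          - (-A.traceβ L / (2 * n)) • (A.opH A.g).compl₂ A.φ
  | 6 => (1 / 2 : ℝ) • (opA (A.opH L) - A.opPhi (opA (A.opH L)))
  | 7 => opS (A.opV L)
  | 8 => opA (A.opV L)
  | 9 => A.opW L
  | _ => 0

theorem metricTrace_add (B C : V →ₗ[ℝ] V →ₗ[ℝ] ℝ) :
    A.metricTrace (B + C) = A.metricTrace B + A.metricTrace C := by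
  rw [metricTrace, LinearMap.comp_add, map_add]; rfl

theorem metricTrace_smul (c : ℝ) (B : V →ₗ[ℝ] V →ₗ[ℝ] ℝ) :
    A.metricTrace (c • B) = c * A.metricTrace B := by
  rw [metricTrace, LinearMap.comp_smul, map_smul]; rfl

theorem traceα_add (L K : V →ₗ[ℝ] V →ₗ[ℝ] ℝ) :
    A.traceα (L + K) = A.traceα L + A.traceα K :=
  A.metricTrace_add (A.opH L) (A.opH K)

theorem traceβ_add (L K : V →ₗ[ℝ] V →ₗ[ℝ] ℝ) :
    A.traceβ (L + K) = A.traceβ L + A.traceβ K :=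
  A.metricTrace_add ((A.opH L).compl₂ A.φ) ((A.opH K).compl₂ A.φ)

theorem traceα_smul (c : ℝ) (L : V →ₗ[ℝ] V →ₗ[ℝ] ℝ) :
    A.traceα (c • L) = c * A.traceα L :=
  A.metricTrace_smul c (A.opH L)

theorem traceβ_smul (c : ℝ) (L : V →ₗ[ℝ] V →ₗ[ℝ] ℝ) :
    A.traceβ (c • L) = c * A.traceβ L :=
  A.metricTrace_smul c ((A.opH L).compl₂ A.φ)

theorem component_add (i : ℕ) (L K : V →ₗ[ℝ] V →ₗ[ℝ] ℝ) :
    A.component i (L + K) = A.component i L + A.component i K := by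
  unfold component
  split <;> ext x y <;>
    simp [opS, opA, opH, opV, opW, opPhi, traceα_add, traceβ_add] <;> ring

theorem component_smul (i : ℕ) (c : ℝ) (L : V →ₗ[ℝ] V →ₗ[ℝ] ℝ) :
    A.component i (c • L) = c • A.component i L := by
  unfold component
  split <;> ext x y <;>
    simp [opS, opA, opH, opV, opW, opPhi, traceα_smul, traceβ_smul] <;> ring

/-- The subspace `{L : L = L_i(L)}` of the space of tensors of type (0,2). -/
noncomputable def subspace (i : ℕ) : Submodule ℝ (V →ₗ[ℝ] V →ₗ[ℝ] ℝ) where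
  carrier := {L | L = A.component i L}
  zero_mem' := by
    have := A.component_smul i 0 0
    rw [zero_smul, zero_smul] at this
    exact this.symm
  add_mem' {L K} hL hK := by
    change L + K = A.component i (L + K)
    rw [component_add, ← hL, ← hK]
  smul_mem' c L hL := by
    change c • L = A.component i (c • L)
    rw [component_smul, ← hL]

end AlmostContactMetricSpace

end AlmostContactMetricAlgebra

section RiemannianManifold

variable {m : ℕ} {M : Type*} [TopologicalSpace M] [ChartedSpace (EuclideanSpace ℝ (Fin m)) M]

/-- Smooth Riemannian metrics on a smooth `m`-manifold `M`. -/
abbrev SmoothMetric (m : ℕ) (M : Type*) [TopologicalSpace M]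
    [ChartedSpace (EuclideanSpace ℝ (Fin m)) M] [IsManifold (𝓡 m) ∞ M] :=
  ContMDiffRiemannianMetric (𝓡 m) ∞ (EuclideanSpace ℝ (Fin m))
    (fun p : M => TangentSpace (𝓡 m) p)

/-- Smooth 1-forms on a smooth `m`-manifold `M`. -/
structure OneForm (m : ℕ) (M : Type*) [TopologicalSpace M]
    [ChartedSpace (EuclideanSpace ℝ (Fin m)) M] [IsManifold (𝓡 m) ∞ M] where
  /-- the covector at each point -/
  toFun : ∀ p : M, TangentSpace (𝓡 m) p →L[ℝ] ℝ
  smooth : ContMDiff (𝓡 m) ((𝓡 m).prod 𝓘(ℝ, EuclideanSpace ℝ (Fin m) →L[ℝ] ℝ)) ∞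
    (fun p => TotalSpace.mk' (EuclideanSpace ℝ (Fin m) →L[ℝ] ℝ) p (toFun p))

variable [IsManifold (𝓡 m) ∞ M]

/-- The vector field `X` is differentiable at the point `p`. -/
abbrev VDiffAt (X : ∀ p : M, TangentSpace (𝓡 m) p) (p : M) : Prop :=
  MDifferentiableAt (𝓡 m) ((𝓡 m).prod 𝓘(ℝ, EuclideanSpace ℝ (Fin m)))
    (fun q => TotalSpace.mk' (EuclideanSpace ℝ (Fin m))
      (E := fun q : M => TangentSpace (𝓡 m) q) q (X q)) p

instance (p : M) : FiniteDimensional ℝ (TangentSpace (𝓡 m) p) :=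
  inferInstanceAs (FiniteDimensional ℝ (EuclideanSpace ℝ (Fin m)))
instance (p : M) : T2Space (TangentSpace (𝓡 m) p) :=
  inferInstanceAs (T2Space (EuclideanSpace ℝ (Fin m)))

theorem SmoothMetric.mdiffAt (g : SmoothMetric m M) {X Y : ∀ p : M, TangentSpace (𝓡 m) p} {p : M}
    (hX : VDiffAt X p) (hY : VDiffAt Y p) :
    MDifferentiableAt (𝓡 m) 𝓘(ℝ, ℝ) (fun q => g.inner q (X q) (Y q)) p := by
  have : MDifferentiableAt (𝓡 m) ((𝓡 m).prod 𝓘(ℝ))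
      (fun m ↦ TotalSpace.mk' ℝ (E := Bundle.Trivial M ℝ) m (g.inner m (X m) (Y m))) p := by
    apply MDifferentiableAt.clm_bundle_apply₂ (F₁ := EuclideanSpace ℝ (Fin m)) (F₂ := EuclideanSpace ℝ (Fin m))
    · exact g.contMDiff.mdifferentiableAt (by simp)
    · exact hX
    · exact hY
  simp only [mdifferentiableAt_totalSpace] at this
  exact this.2

theorem OneForm.mdiffAt (θ : OneForm m M) {Y : ∀ p : M, TangentSpace (𝓡 m) p} {p : M}
    (hY : VDiffAt Y p) :
    MDifferentiableAt (𝓡 m) 𝓘(ℝ, ℝ) (fun q => θ.toFun q (Y q)) p := by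
  have : MDifferentiableAt (𝓡 m) ((𝓡 m).prod 𝓘(ℝ))
      (fun m ↦ TotalSpace.mk' ℝ (E := Bundle.Trivial M ℝ) m (θ.toFun m (Y m))) p := by
    apply MDifferentiableAt.clm_bundle_apply (F₁ := EuclideanSpace ℝ (Fin m)) 
    · exact θ.smooth.mdifferentiableAt (by simp)
    · exact hY
  simp only [mdifferentiableAt_totalSpace] at this
  exact this.2

/-- The musical isomorphism `T_p M ≃ T_p^* M` of the metric `g`, `v ↦ g(v, ·)`. -/
noncomputable def SmoothMetric.flat (g : SmoothMetric m M) (p : M) :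
    TangentSpace (𝓡 m) p ≃ₗ[ℝ] (TangentSpace (𝓡 m) p →L[ℝ] ℝ) :=
  LinearEquiv.ofInjectiveOfFinrankEq (g.inner p).toLinearMap
    ((injective_iff_map_eq_zero _).2 fun v hv => by
      by_contra h
      have := g.pos p v h
      have h2 : g.inner p v v = 0 := by
        have : g.inner p v = 0 := hv
        rw [this]; rfl
      exact absurd h2 this.ne') 
    (by
      rw [← (LinearMap.toContinuousLinearMap : (TangentSpace (𝓡 m) p →ₗ[ℝ] ℝ) ≃ₗ[ℝ] _).finrank_eq]
      exact (Subspace.dual_finrank_eq).symm)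

theorem SmoothMetric.flat_apply (g : SmoothMetric m M) (p : M) (v w : TangentSpace (𝓡 m) p) :
    g.flat p v w = g.inner p v w := rfl

theorem SmoothMetric.inner_flat_symm (g : SmoothMetric m M) (p : M)
    (a : TangentSpace (𝓡 m) p →L[ℝ] ℝ) (w : TangentSpace (𝓡 m) p) :
    g.inner p ((g.flat p).symm a) w = a w := by
  rw [← g.flat_apply, LinearEquiv.apply_symm_apply]

/-- The Koszul expression, equal to `2 g(∇_X Y, Z)` at `p` for the Levi-Civita connection `∇`. -/
noncomputable def SmoothMetric.koszul (g : SmoothMetric m M) (Y : ∀ p : M, TangentSpace (𝓡 m) p)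
    (p : M) (X Z : ∀ p : M, TangentSpace (𝓡 m) p) : ℝ :=
  mvfderiv (𝓡 m) (fun q => g.inner q (Y q) (Z q)) p (X p)
    + mvfderiv (𝓡 m) (fun q => g.inner q (Z q) (X q)) p (Y p)
    - mvfderiv (𝓡 m) (fun q => g.inner q (X q) (Y q)) p (Z p)
    + g.inner p (VectorField.mlieBracket (𝓡 m) X Y p) (Z p)
    - g.inner p (VectorField.mlieBracket (𝓡 m) X Z p) (Y p)
    - g.inner p (VectorField.mlieBracket (𝓡 m) Y Z p) (X p)

theorem SmoothMetric.koszul_add_mid (g : SmoothMetric m M) {X Y Y' Z : ∀ p : M, TangentSpace (𝓡 m) p}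
    {p : M} (hX : VDiffAt X p) (hY : VDiffAt Y p) (hY' : VDiffAt Y' p) (hZ : VDiffAt Z p) :
    g.koszul (Y + Y') p X Z = g.koszul Y p X Z + g.koszul Y' p X Z := by
  have e1 := mvfderiv_fun_add (g.mdiffAt hY hZ) (g.mdiffAt hY' hZ)
  have e2 := mvfderiv_fun_add (g.mdiffAt hX hY) (g.mdiffAt hX hY')
  simp only [koszul, VectorField.mlieBracket_add_left hY hY', VectorField.mlieBracket_add_right hY hY',
    Pi.add_apply, map_add, _root_.add_apply, e1, e2]
  ring

theorem SmoothMetric.koszul_smul_mid (g : SmoothMetric m M) {X Y Z : ∀ p : M, TangentSpace (𝓡 m) p}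
    {f : M → ℝ} {p : M} (hf : MDifferentiableAt (𝓡 m) 𝓘(ℝ, ℝ) f p)
    (hX : VDiffAt X p) (hY : VDiffAt Y p) (hZ : VDiffAt Z p) :
    g.koszul (f • Y) p X Z = f p * g.koszul Y p X Z
      + 2 * (mvfderiv (𝓡 m) f p (X p) * g.inner p (Y p) (Z p)) := by
  have e1 := mvfderiv_fun_mul hf (g.mdiffAt hY hZ)
  have e2 := mvfderiv_fun_mul hf (g.mdiffAt hX hY)
  simp only [koszul, VectorField.mlieBracket_smul_left hf hY, VectorField.mlieBracket_smul_right hf hY,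
    Pi.smul_apply', map_add, map_smul, map_neg, _root_.add_apply, _root_.neg_apply, _root_.smul_apply, smul_eq_mul, e1, e2,
    neg_smul]
  rw [g.symm p (X p) (Y p)]
  ring

theorem SmoothMetric.koszul_tensorial_left (g : SmoothMetric m M) {Y Z : ∀ p : M, TangentSpace (𝓡 m) p}
    {p : M} (hY : VDiffAt Y p) (hZ : VDiffAt Z p) :
    TensorialAt (𝓡 m) (EuclideanSpace ℝ (Fin m)) (fun X => g.koszul Y p X Z) p where
  add {X X'} hX hX' := by
    have e1 := mvfderiv_fun_add (g.mdiffAt hZ hX) (g.mdiffAt hZ hX')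
    have e2 := mvfderiv_fun_add (g.mdiffAt hX hY) (g.mdiffAt hX' hY)
    simp only [koszul, VectorField.mlieBracket_add_left hX hX',
      Pi.add_apply, map_add, _root_.add_apply, e1, e2]
    ring
  smul {f X} hf hX := by
    have e1 := mvfderiv_fun_mul hf (g.mdiffAt hZ hX)
    have e2 := mvfderiv_fun_mul hf (g.mdiffAt hX hY)
    simp only [koszul, VectorField.mlieBracket_smul_left hf hX, 
      Pi.smul_apply', map_add, map_smul, map_neg, _root_.add_apply, _root_.neg_apply, _root_.smul_apply,
      smul_eq_mul, e1, e2, neg_smul]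
    rw [g.symm p (Z p) (X p)]
    ring

theorem SmoothMetric.koszul_tensorial_right (g : SmoothMetric m M) {Y X : ∀ p : M, TangentSpace (𝓡 m) p}
    {p : M} (hY : VDiffAt Y p) (hX : VDiffAt X p) :
    TensorialAt (𝓡 m) (EuclideanSpace ℝ (Fin m)) (fun Z => g.koszul Y p X Z) p where
  add {Z Z'} hZ hZ' := by
    have e1 := mvfderiv_fun_add (g.mdiffAt hZ hX) (g.mdiffAt hZ' hX)
    have e2 := mvfderiv_fun_add (g.mdiffAt hY hZ) (g.mdiffAt hY hZ')
    simp only [koszul, VectorField.mlieBracket_add_right hZ hZ',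
      Pi.add_apply, map_add, _root_.add_apply, e1, e2]
    ring
  smul {f Z} hf hZ := by
    have e1 := mvfderiv_fun_mul hf (g.mdiffAt hZ hX)
    have e2 := mvfderiv_fun_mul hf (g.mdiffAt hY hZ)
    simp only [koszul, VectorField.mlieBracket_smul_right hf hZ, 
      Pi.smul_apply', map_add, map_smul, _root_.add_apply, _root_.smul_apply, smul_eq_mul, e1, e2]
    rw [g.symm p (Z p) (X p), g.symm p (Z p) (Y p)]
    ring

open Classical in
/-- The Koszul expression of a vector field `Y` differentiable at `p`, as a bilinear form in the
values of `X` and `Z` at `p`. (Zero if `Y` is not differentiable at `p`.) -/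
noncomputable def SmoothMetric.koszulHom (g : SmoothMetric m M) (Y : ∀ p : M, TangentSpace (𝓡 m) p)
    (p : M) : TangentSpace (𝓡 m) p →L[ℝ] TangentSpace (𝓡 m) p →L[ℝ] ℝ :=
  if hY : VDiffAt Y p then
    TensorialAt.mkHom₂ (I := 𝓡 m) (F := EuclideanSpace ℝ (Fin m)) (F' := EuclideanSpace ℝ (Fin m))
      (V := fun q : M => TangentSpace (𝓡 m) q) (V' := fun q : M => TangentSpace (𝓡 m) q)
      (g.koszul Y p) p
      (fun _ hZ => g.koszul_tensorial_left hY hZ) (fun _ hX => g.koszul_tensorial_right hY hX)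
  else 0

theorem SmoothMetric.koszulHom_apply (g : SmoothMetric m M) {X Y Z : ∀ p : M, TangentSpace (𝓡 m) p}
    {p : M} (hX : VDiffAt X p) (hY : VDiffAt Y p) (hZ : VDiffAt Z p) :
    g.koszulHom Y p (X p) (Z p) = g.koszul Y p X Z := by
  rw [koszulHom, dif_pos hY]
  exact TensorialAt.mkHom₂_apply _ _ hX hZ

theorem exists_mdiffAt_vectorField (p : M) (v : TangentSpace (𝓡 m) p) :
    ∃ X : ∀ q : M, TangentSpace (𝓡 m) q, VDiffAt X p ∧ X p = v :=
  ⟨FiberBundle.extend (EuclideanSpace ℝ (Fin m)) v, FiberBundle.mdifferentiableAt_extend (I := 𝓡 m) .., by simp⟩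

/-- The map `x ↦ ∇_x Y` at the point `p`, determined by `2 g(∇_x Y, z) = Koszul expression`. -/
noncomputable def SmoothMetric.leviCivitaFun (g : SmoothMetric m M)
    (Y : ∀ p : M, TangentSpace (𝓡 m) p) (p : M) :
    TangentSpace (𝓡 m) p →L[ℝ] TangentSpace (𝓡 m) p :=
  LinearMap.toContinuousLinearMap
    ((1 / 2 : ℝ) • ((g.flat p).symm.toLinearMap ∘ₗ (g.koszulHom Y p).toLinearMap))

theorem SmoothMetric.inner_leviCivitaFun (g : SmoothMetric m M)
    {X Y Z : ∀ p : M, TangentSpace (𝓡 m) p}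
    {p : M} (hX : VDiffAt X p) (hY : VDiffAt Y p) (hZ : VDiffAt Z p) :
    2 * g.inner p (g.leviCivitaFun Y p (X p)) (Z p) = g.koszul Y p X Z := by
  rw [← g.koszulHom_apply hX hY hZ, ← g.inner_flat_symm p (g.koszulHom Y p (X p))]
  simp [leviCivitaFun]

theorem SmoothMetric.ext_inner (g : SmoothMetric m M) {p : M} {v w : TangentSpace (𝓡 m) p}
    (h : ∀ Z : ∀ p : M, TangentSpace (𝓡 m) p, VDiffAt Z p →
      g.inner p v (Z p) = g.inner p w (Z p)) : v = w := by
  apply (g.flat p).injective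
  ext z
  obtain ⟨Z, hZ, rfl⟩ := exists_mdiffAt_vectorField p z
  exact h Z hZ

/-- The Levi-Civita connection of the metric `g`. -/
noncomputable def SmoothMetric.leviCivita (g : SmoothMetric m M) :
    CovariantDerivative (𝓡 m) (EuclideanSpace ℝ (Fin m)) (fun p : M => TangentSpace (𝓡 m) p) where
  toFun := g.leviCivitaFun
  isCovariantDerivativeOnUniv :=
    { add := by
        intro Y Y' p hY hY' _
        ext x : 1
        obtain ⟨X, hX, rfl⟩ := exists_mdiffAt_vectorField p x
        refine g.ext_inner fun Z hZ => ?_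
        have hYY : VDiffAt (Y + Y') p := mdifferentiableAt_add_section hY hY'
        have h1 := g.inner_leviCivitaFun hX hY hZ
        have h2 := g.inner_leviCivitaFun hX hY' hZ
        have h3 := g.inner_leviCivitaFun hX hYY hZ
        rw [g.koszul_add_mid hX hY hY' hZ] at h3
        simp only [_root_.add_apply, map_add]
        linarith
      leibniz := by
        intro Y f p hY hf _
        ext x : 1
        obtain ⟨X, hX, rfl⟩ := exists_mdiffAt_vectorField p x
        refine g.ext_inner fun Z hZ => ?_
        have hYY : VDiffAt (f • Y) p := hf.smul_section hY
        have h1 := g.inner_leviCivitaFun hX hY hZ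
        have h3 := g.inner_leviCivitaFun hX hYY hZ
        rw [g.koszul_smul_mid hf hX hY hZ, ← h1] at h3
        simp only [_root_.add_apply, map_add, _root_.smul_apply, map_smul,
          ContinuousLinearMap.smulRight_apply, smul_eq_mul]
        linarith }

theorem SmoothMetric.inner_neg_left (g : SmoothMetric m M) (p : M) (v w : TangentSpace (𝓡 m) p) :
    g.inner p (-v) w = - g.inner p v w := by
  have := congrArg (fun a => a w) ((g.inner p).map_neg v)
  exact this

theorem SmoothMetric.leviCivita_metric (g : SmoothMetric m M)
    {X Y Z : ∀ p : M, TangentSpace (𝓡 m) p}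
    {p : M} (hX : VDiffAt X p) (hY : VDiffAt Y p) (hZ : VDiffAt Z p) :
    mvfderiv (𝓡 m) (fun q => g.inner q (Y q) (Z q)) p (X p)
      = g.inner p (g.leviCivita Y p (X p)) (Z p) + g.inner p (Y p) (g.leviCivita Z p (X p)) := by
  have h1 := g.inner_leviCivitaFun hX hY hZ
  have h2 := g.inner_leviCivitaFun hX hZ hY
  rw [g.symm p (Y p)]
  change _ = g.inner p (g.leviCivitaFun Y p (X p)) (Z p) + g.inner p (g.leviCivitaFun Z p (X p)) (Y p)
  have e : ∀ A B : ∀ p : M, TangentSpace (𝓡 m) p, (fun q => g.inner q (A q) (B q)) = fun q => g.inner q (B q) (A q) :=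
    fun A B => funext fun q => g.symm q _ _
  simp only [koszul] at h1 h2
  rw [VectorField.mlieBracket_swap_apply (V := Z) (W := Y), e Z Y, e X Z, e Y X] at h2
  rw [inner_neg_left] at h2
  linarith

theorem SmoothMetric.leviCivita_torsion (g : SmoothMetric m M) :
    g.leviCivita.torsion = 0 := by
  rw [CovariantDerivative.torsion_eq_zero_iff]
  intro X Y p hX hY
  refine g.ext_inner fun Z hZ => ?_
  have h1 := g.inner_leviCivitaFun hX hY hZ
  have h2 := g.inner_leviCivitaFun hY hX hZ
  rw [map_sub, _root_.sub_apply]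
  change g.inner p (g.leviCivitaFun Y p (X p)) (Z p) - g.inner p (g.leviCivitaFun X p (Y p)) (Z p) = _
  have e : ∀ A B : ∀ p : M, TangentSpace (𝓡 m) p, (fun q => g.inner q (A q) (B q)) = fun q => g.inner q (B q) (A q) :=
    fun A B => funext fun q => g.symm q _ _
  simp only [koszul] at h1 h2
  rw [VectorField.mlieBracket_swap_apply (V := Y) (W := X), e X Z, e Z Y, e Y X] at h2
  rw [inner_neg_left] at h2
  linarith

/-- The vector field `X` is smooth near the point `p`. -/
abbrev VSmoothAt (X : ∀ p : M, TangentSpace (𝓡 m) p) (p : M) : Prop :=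
  ContMDiffAt (𝓡 m) ((𝓡 m).prod 𝓘(ℝ, EuclideanSpace ℝ (Fin m))) ∞
    (fun q => TotalSpace.mk' (EuclideanSpace ℝ (Fin m))
      (E := fun q : M => TangentSpace (𝓡 m) q) q (X q)) p

/-- The vector field `θ*` dual to a 1-form `θ`, determined by `g(θ*, y) = θ(y)`. -/
noncomputable def OneForm.dual (θ : OneForm m M) (g : SmoothMetric m M) (p : M) :
    TangentSpace (𝓡 m) p :=
  (g.flat p).symm (θ.toFun p)

/-- The 1-form `θ` is closed: `dθ(X, Y) = X(θ(Y)) - Y(θ(X)) - θ([X, Y])` vanishes for all smooth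
local vector fields `X`, `Y`. -/
def OneForm.IsClosed (θ : OneForm m M) : Prop :=
  ∀ (p : M) (X Y : ∀ q : M, TangentSpace (𝓡 m) q), VSmoothAt X p → VSmoothAt Y p →
    mvfderiv (𝓡 m) (fun q => θ.toFun q (Y q)) p (X p)
      - mvfderiv (𝓡 m) (fun q => θ.toFun q (X q)) p (Y p)
      - θ.toFun p (VectorField.mlieBracket (𝓡 m) X Y p) = 0

/-- The vector field `X` is a Killing vector field: the Lie derivative
`(L_X g)(Y, Z) = X(g(Y, Z)) - g([X, Y], Z) - g(Y, [X, Z])` vanishes for all smooth local vector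
fields `Y`, `Z`. -/
def SmoothMetric.IsKilling (g : SmoothMetric m M) (X : ∀ q : M, TangentSpace (𝓡 m) q) : Prop :=
  ∀ (p : M) (Y Z : ∀ q : M, TangentSpace (𝓡 m) q), VSmoothAt Y p → VSmoothAt Z p →
    mvfderiv (𝓡 m) (fun q => g.inner q (Y q) (Z q)) p (X p)
      - g.inner p (VectorField.mlieBracket (𝓡 m) X Y p) (Z p)
      - g.inner p (Y p) (VectorField.mlieBracket (𝓡 m) X Z p) = 0

/-- `(∇_X θ)(Y) = X(θ(Y)) - θ(∇_X Y)` at the point `p`. -/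
noncomputable def OneForm.nablaAux (θ : OneForm m M) (g : SmoothMetric m M) (p : M)
    (X Y : ∀ q : M, TangentSpace (𝓡 m) q) : ℝ :=
  mvfderiv (𝓡 m) (fun q => θ.toFun q (Y q)) p (X p) - θ.toFun p (g.leviCivita Y p (X p))

theorem OneForm.nablaAux_tensorial_left (θ : OneForm m M) (g : SmoothMetric m M) (p : M)
    (Y : ∀ q : M, TangentSpace (𝓡 m) q) :
    TensorialAt (𝓡 m) (EuclideanSpace ℝ (Fin m)) (fun X => θ.nablaAux g p X Y) p where
  add {X X'} _ _ := by
    simp only [nablaAux, Pi.add_apply, map_add]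
    ring
  smul {f X} _ _ := by
    simp only [nablaAux, Pi.smul_apply', map_smul, smul_eq_mul]
    ring

theorem OneForm.nablaAux_tensorial_right (θ : OneForm m M) (g : SmoothMetric m M) (p : M)
    (X : ∀ q : M, TangentSpace (𝓡 m) q) :
    TensorialAt (𝓡 m) (EuclideanSpace ℝ (Fin m)) (fun Y => θ.nablaAux g p X Y) p where
  add {Y Y'} hY hY' := by
    have e1 := mvfderiv_fun_add (θ.mdiffAt hY) (θ.mdiffAt hY')
    have e2 := g.leviCivita.isCovariantDerivativeOnUniv.add hY hY'
    simp only [nablaAux, Pi.add_apply, map_add, _root_.add_apply, e1, e2]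
    ring
  smul {f Y} hf hY := by
    have e1 := mvfderiv_fun_mul hf (θ.mdiffAt hY)
    have e2 := g.leviCivita.isCovariantDerivativeOnUniv.leibniz hY hf
    simp only [nablaAux, Pi.smul_apply', map_add, map_smul, _root_.add_apply, _root_.smul_apply,
      ContinuousLinearMap.smulRight_apply, smul_eq_mul, e1, e2]
    ring

/-- The covariant derivative `∇θ` of a 1-form with respect to the Levi-Civita connection of `g`, a
tensor field of type (0,2): `(∇θ)(x, y) = (∇_x θ)(y)`. -/
noncomputable def OneForm.nabla (θ : OneForm m M) (g : SmoothMetric m M) (p : M) :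
    TangentSpace (𝓡 m) p →L[ℝ] TangentSpace (𝓡 m) p →L[ℝ] ℝ :=
  TensorialAt.mkHom₂ (I := 𝓡 m) (F := EuclideanSpace ℝ (Fin m)) (F' := EuclideanSpace ℝ (Fin m))
    (V := fun q : M => TangentSpace (𝓡 m) q) (V' := fun q : M => TangentSpace (𝓡 m) q)
    (θ.nablaAux g p) p
    (fun Y _ => θ.nablaAux_tensorial_left g p Y) (fun X _ => θ.nablaAux_tensorial_right g p X)

theorem OneForm.nabla_apply (θ : OneForm m M) (g : SmoothMetric m M) {p : M}
    {X Y : ∀ q : M, TangentSpace (𝓡 m) q} (hX : VDiffAt X p) (hY : VDiffAt Y p) :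
    θ.nabla g p (X p) (Y p) =
      mvfderiv (𝓡 m) (fun q => θ.toFun q (Y q)) p (X p)
        - θ.toFun p (g.leviCivita Y p (X p)) :=
  TensorialAt.mkHom₂_apply _ _ hX hY

end RiemannianManifold

section AlmostContactMetricManifold

/-- An almost contact metric structure `(φ, ξ, η, g)` on a smooth manifold `M` of dimension
`2n + 1`. -/
structure AlmostContactMetricStructure (n : ℕ) (M : Type*) [TopologicalSpace M]
    [ChartedSpace (EuclideanSpace ℝ (Fin (2 * n + 1))) M] [IsManifold (𝓡 (2 * n + 1)) ∞ M] where
  /-- the tensor field of type (1,1) -/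
  φ : ∀ p : M, TangentSpace (𝓡 (2 * n + 1)) p →L[ℝ] TangentSpace (𝓡 (2 * n + 1)) p
  smooth_φ : ContMDiff (𝓡 (2 * n + 1))
    ((𝓡 (2 * n + 1)).prod 𝓘(ℝ, EuclideanSpace ℝ (Fin (2 * n + 1)) →L[ℝ]
      EuclideanSpace ℝ (Fin (2 * n + 1)))) ∞
    (fun p => TotalSpace.mk' (EuclideanSpace ℝ (Fin (2 * n + 1)) →L[ℝ]
      EuclideanSpace ℝ (Fin (2 * n + 1)))
      (E := fun p : M => TangentSpace (𝓡 (2 * n + 1)) p →L[ℝ] TangentSpace (𝓡 (2 * n + 1)) p)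
      p (φ p))
  /-- the characteristic vector field -/
  ξ : ∀ p : M, TangentSpace (𝓡 (2 * n + 1)) p
  smooth_ξ : ∀ p, VSmoothAt ξ p
  /-- the characteristic 1-form -/
  η : OneForm (2 * n + 1) M
  /-- the Riemannian metric -/
  g : SmoothMetric (2 * n + 1) M
  φ_sq : ∀ p x, φ p (φ p x) = -x + η.toFun p x • ξ p
  φ_ξ : ∀ p, φ p (ξ p) = 0
  η_φ : ∀ p x, η.toFun p (φ p x) = 0
  g_ξ : ∀ p, g.inner p (ξ p) (ξ p) = 1
  g_φ : ∀ p x y, g.inner p (φ p x) (φ p y) = g.inner p x y - η.toFun p x * η.toFun p y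

namespace AlmostContactMetricStructure

variable {n : ℕ} {M : Type*} [TopologicalSpace M]
  [ChartedSpace (EuclideanSpace ℝ (Fin (2 * n + 1))) M] [IsManifold (𝓡 (2 * n + 1)) ∞ M]

/-- A continuous bilinear form on a tangent space, as a bilinear form. -/
noncomputable def toBilin {m : ℕ} {M : Type*} [TopologicalSpace M] [ChartedSpace (EuclideanSpace ℝ (Fin m)) M]
    {p : M} (B : TangentSpace (𝓡 m) p →L[ℝ] TangentSpace (𝓡 m) p →L[ℝ] ℝ) :
    TangentSpace (𝓡 m) p →ₗ[ℝ] TangentSpace (𝓡 m) p →ₗ[ℝ] ℝ :=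
  ContinuousLinearMap.coeLM ℝ ∘ₗ B.toLinearMap

/-- The tangent space at `p` as an almost contact metric vector space. -/
noncomputable def tangent (S : AlmostContactMetricStructure n M) (p : M) :
    AlmostContactMetricSpace n (TangentSpace (𝓡 (2 * n + 1)) p) where
  finrank_eq := (finrank_euclideanSpace_fin (𝕜 := ℝ) (n := 2 * n + 1) :)
  φ := (S.φ p).toLinearMap
  ξ := S.ξ p
  η := (S.η.toFun p).toLinearMap
  g := toBilin (S.g.inner p)
  g_symm := S.g.symm p
  g_pos := S.g.pos p
  φ_sq := S.φ_sq p
  φ_ξ := S.φ_ξ p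
  g_ξ := S.g_ξ p
  g_φ := S.g_φ p

/-- The tensor `L(θ) = ∇θ` at the point `p`. -/
noncomputable def nablaAt (S : AlmostContactMetricStructure n M) (θ : OneForm (2 * n + 1) M)
    (p : M) : TangentSpace (𝓡 (2 * n + 1)) p →ₗ[ℝ] TangentSpace (𝓡 (2 * n + 1)) p →ₗ[ℝ] ℝ :=
  toBilin (θ.nabla S.g p)

/-- The space `Ω_i` of 1-forms `θ` with `L(θ) = L_i(θ)`. -/
def Omega (S : AlmostContactMetricStructure n M) (i : ℕ) : Set (OneForm (2 * n + 1) M) :=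
  {θ | ∀ p, S.nablaAt θ p = (S.tangent p).component i (S.nablaAt θ p)}

/-- The space `⨁_{i ∈ I} Ω_i`: the 1-forms `θ` for which `L(θ)` lies at every point in the sum over
`i ∈ I` of the subspaces `{L : L = L_i(L)}` of tensors. (In general this is larger than the sum of
the spaces `Ω_i` inside the space of 1-forms.) -/
def OmegaSum (S : AlmostContactMetricStructure n M) (I : Finset ℕ) :
    Set (OneForm (2 * n + 1) M) :=
  {θ | ∀ p, S.nablaAt θ p ∈ ⨆ i ∈ I, (S.tangent p).subspace i}

theorem OmegaSum_singleton (S : AlmostContactMetricStructure n M) (i : ℕ) :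
    S.OmegaSum {i} = S.Omega i := by
  ext θ
  simp only [OmegaSum, Finset.mem_singleton, iSup_iSup_eq_left]
  rfl

end AlmostContactMetricStructure

end AlmostContactMetricManifold

/-! The theorem splits into pointwise linear algebra and calculus with the Levi-Civita connection.

Algebra: the splitting x = hx + η(x)ξ gives L = hL + vL + wL, where wL is always symmetric. The
operators `component 1`, `component 2` and `component 3` add up to ShL, and `component 4`,
`component 5` and `component 6` to AhL. Hence a symmetric L is the sum of its components 1, 2, 3, 7,
9, and a skew L is the sum of its components 4, 5, 6, 8. Each component map is idempotent, so every
summand lies in the matching subspace. Conversely, the first family of maps takes only symmetric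
values and the second only skew ones. The two sums are therefore exactly the symmetric and the skew
tensors (`mem_iSup_subspace_iff_symm`, `mem_iSup_subspace_iff_skew`). Idempotence is delicate only
for the components that involve α and β, which is why the behaviour of these traces under flip and
under L ↦ L∘φ is needed.

Calculus: vanishing torsion turns dθ(X, Y) into (∇θ)(X, Y) - (∇θ)(Y, X). Vanishing torsion and
metric compatibility turn the Lie derivative of g along θ* into (∇θ)(Y, Z) + (∇θ)(Z, Y). So closed
means that ∇θ is symmetric, and Killing means that it is skew. -/

namespace AlmostContactMetricSpace

variable {n : ℕ} {V : Type*} [AddCommGroup V] [Module ℝ V] (A : AlmostContactMetricSpace n V)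

/-! ### Pointwise identities for φ, ξ, η, g and h -/

theorem ξ_ne_zero : A.ξ ≠ 0 := fun h => by
  have := A.g_ξ
  simp [h] at this

theorem η_ξ : A.η A.ξ = 1 := by
  have h := A.φ_sq A.ξ
  rw [A.φ_ξ, map_zero] at h
  have h' : (A.η A.ξ - 1) • A.ξ = 0 := by rw [sub_smul, one_smul, h]; abel
  rcases smul_eq_zero.1 h' with h' | h'
  · linarith
  · exact absurd h' A.ξ_ne_zero

/-- Compare the two ways of computing φ³x: as φ²(φx) and as φ(φ²x). They differ by η(φx)ξ, and ξ ≠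
0. -/
theorem η_φ (x : V) : A.η (A.φ x) = 0 := by
  have h := A.φ_sq (A.φ x)
  rw [A.φ_sq x, map_add, map_neg, map_smul, A.φ_ξ, smul_zero, add_zero] at h
  exact (smul_eq_zero.1 (left_eq_add.1 h)).resolve_right A.ξ_ne_zero

theorem hEnd_apply (x : V) : A.hEnd x = x - A.η x • A.ξ := by
  simp only [hEnd, LinearMap.neg_apply, LinearMap.comp_apply, A.φ_sq]
  abel

theorem φ_φ (x : V) : A.φ (A.φ x) = -A.hEnd x := by
  rw [hEnd_apply, φ_sq]; abel

theorem φ_hEnd (x : V) : A.φ (A.hEnd x) = A.φ x := by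
  rw [hEnd_apply, map_sub, map_smul, φ_ξ, smul_zero, sub_zero]

theorem hEnd_φ (x : V) : A.hEnd (A.φ x) = A.φ x := by
  rw [hEnd_apply, η_φ, zero_smul, sub_zero]

theorem η_hEnd (x : V) : A.η (A.hEnd x) = 0 := by
  rw [hEnd_apply, map_sub, map_smul, η_ξ, smul_eq_mul, mul_one, sub_self]

theorem hEnd_hEnd (x : V) : A.hEnd (A.hEnd x) = A.hEnd x := by
  rw [hEnd_apply _ (A.hEnd x), η_hEnd, zero_smul, sub_zero]

theorem g_ξ_left (y : V) : A.g A.ξ y = A.η y := by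
  have h := A.g_φ A.ξ y
  rw [φ_ξ, η_ξ, map_zero, LinearMap.zero_apply] at h
  linarith

/-- Put φy for y in the compatibility of g with φ: the terms with η vanish because η∘φ = 0. Skewness
of φ moves every φ across the metric in the trace computations. -/
theorem g_φ_left (x y : V) : A.g (A.φ x) y = -A.g x (A.φ y) := by
  have h := A.g_φ x (A.φ y)
  rw [A.η_φ, A.φ_sq, map_add, map_neg, map_smul, A.g_symm _ A.ξ, g_ξ_left, A.η_φ] at h
  simp only [smul_zero, mul_zero, add_zero, sub_zero] at h
  linarith

theorem g_hEnd_left (x y : V) : A.g (A.hEnd x) y = A.g x (A.hEnd y) := by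
  simp only [hEnd, LinearMap.neg_apply, LinearMap.comp_apply, map_neg, g_φ_left]
  simp

theorem g_hEnd_hEnd (x y : V) : A.g (A.hEnd x) (A.hEnd y) = A.g x (A.hEnd y) := by
  rw [g_hEnd_left, hEnd_hEnd]

/-! ### Metric traces and the behaviour of α and β -/

theorem metricTrace_eq_trace (B : V →ₗ[ℝ] V →ₗ[ℝ] ℝ) (T : V →ₗ[ℝ] V)
    (h : ∀ x y, B x y = A.g (T x) y) : A.metricTrace B = LinearMap.trace ℝ V T := by
  rw [metricTrace]
  congr 1
  ext x
  rw [LinearMap.comp_apply, LinearEquiv.coe_coe, LinearEquiv.symm_apply_eq]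
  ext y
  rw [h, flat_apply]

theorem exists_operator (B : V →ₗ[ℝ] V →ₗ[ℝ] ℝ) :
    ∃ T : V →ₗ[ℝ] V, ∀ x y, B x y = A.g (T x) y :=
  ⟨A.flat.symm.toLinearMap ∘ₗ B, fun x y => (A.g_flat_symm (B x) y).symm⟩

theorem metricTrace_flip (B : V →ₗ[ℝ] V →ₗ[ℝ] ℝ) : A.metricTrace B.flip = A.metricTrace B := by
  have := A.finiteDimensional
  rw [A.metricTrace_eq_sum (Module.finBasis ℝ V), A.metricTrace_eq_sum (Module.finBasis ℝ V),
    Finset.sum_comm]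
  refine Finset.sum_congr rfl fun i _ => Finset.sum_congr rfl fun j _ => ?_
  rw [A.g_symm, LinearMap.flip_apply]

/-- Since h = id - η⊗ξ, the trace is (2n + 1) - η(ξ). -/
theorem trace_hEnd : LinearMap.trace ℝ V A.hEnd = 2 * n := by
  have := A.finiteDimensional
  have h : A.hEnd = LinearMap.id - A.η.smulRight A.ξ := by
    ext x; simp [hEnd_apply]
  have h2 : A.η.smulRight A.ξ = dualTensorHom ℝ V V (A.η ⊗ₜ[ℝ] A.ξ) := by
    ext x; simp
  rw [h, map_sub, LinearMap.trace_id, A.finrank_eq, h2, LinearMap.trace_eq_contract_apply,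
    contractLeft_apply, η_ξ]
  push_cast; ring

theorem metricTrace_sub (B C : V →ₗ[ℝ] V →ₗ[ℝ] ℝ) :
    A.metricTrace (B - C) = A.metricTrace B - A.metricTrace C := by
  rw [metricTrace, LinearMap.comp_sub, map_sub]; rfl

theorem traceα_sub (L K : V →ₗ[ℝ] V →ₗ[ℝ] ℝ) :
    A.traceα (L - K) = A.traceα L - A.traceα K :=
  A.metricTrace_sub (A.opH L) (A.opH K)

theorem traceβ_sub (L K : V →ₗ[ℝ] V →ₗ[ℝ] ℝ) :
    A.traceβ (L - K) = A.traceβ L - A.traceβ K :=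
  A.metricTrace_sub ((A.opH L).compl₂ A.φ) ((A.opH K).compl₂ A.φ)

theorem traceα_flip (L : V →ₗ[ℝ] V →ₗ[ℝ] ℝ) : A.traceα L.flip = A.traceα L :=
  A.metricTrace_flip (A.opH L)

/-- If T represents hL, then -φTφ represents h(L∘φ). By cyclicity its trace is tr(T∘(-φ²)) = tr(Th),
and Th represents hL as well because h is idempotent. -/
theorem traceα_opPhi (L : V →ₗ[ℝ] V →ₗ[ℝ] ℝ) : A.traceα (A.opPhi L) = A.traceα L := by
  have := A.finiteDimensional
  obtain ⟨T, hT⟩ := A.exists_operator (A.opH L)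
  rw [traceα, A.metricTrace_eq_trace (A.opH (A.opPhi L)) (-(A.φ ∘ₗ T ∘ₗ A.φ)), traceα,
    A.metricTrace_eq_trace (A.opH L) (T ∘ₗ A.hEnd), hEnd, LinearMap.comp_neg, map_neg, map_neg,
    LinearMap.trace_comp_comm', LinearMap.comp_assoc]
  · intro x y
    rw [LinearMap.comp_apply, ← hT]
    simp [opH, hEnd_hEnd]
  · intro x y
    simp only [LinearMap.neg_apply, LinearMap.comp_apply, map_neg, g_φ_left, ← hT]
    simp [opH, opPhi, φ_hEnd, hEnd_φ]

theorem traceβ_eq (L : V →ₗ[ℝ] V →ₗ[ℝ] ℝ) (T : V →ₗ[ℝ] V)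
    (hT : ∀ x y, A.opH L x y = A.g (T x) y) :
    A.traceβ L = -LinearMap.trace ℝ V (A.φ ∘ₗ T) := by
  rw [traceβ, A.metricTrace_eq_trace _ (-(A.φ ∘ₗ T)), map_neg]
  intro x y
  rw [LinearMap.compl₂_apply, hT]
  simp [g_φ_left]

/-- As for α, with one more φ: cyclicity produces φ³, which equals -φ. -/
theorem traceβ_opPhi (L : V →ₗ[ℝ] V →ₗ[ℝ] ℝ) : A.traceβ (A.opPhi L) = A.traceβ L := by
  have := A.finiteDimensional
  obtain ⟨T, hT⟩ := A.exists_operator (A.opH L)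
  have h : A.φ ∘ₗ A.φ ∘ₗ A.φ = -A.φ := by
    ext x; simp [φ_φ, φ_hEnd]
  rw [A.traceβ_eq L T hT, A.traceβ_eq (A.opPhi L) (-(A.φ ∘ₗ T ∘ₗ A.φ))]
  · rw [LinearMap.comp_neg, map_neg, LinearMap.trace_comp_comm', LinearMap.comp_assoc,
      LinearMap.trace_comp_comm', LinearMap.comp_assoc, LinearMap.comp_assoc, h,
      LinearMap.comp_neg, map_neg, LinearMap.trace_comp_comm', neg_neg]
  · intro x y
    simp only [LinearMap.neg_apply, LinearMap.comp_apply, map_neg, g_φ_left, ← hT]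
    simp [opH, opPhi, φ_hEnd, hEnd_φ]

/-- Both sides reduce to tr(φT) = tr(Tφ); the sign is that of the skew map φ. So β sees only the
skew part of hL. -/
theorem traceβ_flip (L : V →ₗ[ℝ] V →ₗ[ℝ] ℝ) : A.traceβ L.flip = -A.traceβ L := by
  have := A.finiteDimensional
  obtain ⟨T, hT⟩ := A.exists_operator (A.opH L)
  rw [A.traceβ_eq L T hT, neg_neg, LinearMap.trace_comp_comm', traceβ, ← metricTrace_flip]
  refine A.metricTrace_eq_trace _ _ fun x y => ?_
  rw [LinearMap.comp_apply, ← hT]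
  simp [opH]

theorem traceα_opH (L : V →ₗ[ℝ] V →ₗ[ℝ] ℝ) : A.traceα (A.opH L) = A.traceα L := by
  rw [traceα, traceα]
  congr 1
  ext x y; simp [opH, hEnd_hEnd]

theorem traceβ_opH (L : V →ₗ[ℝ] V →ₗ[ℝ] ℝ) : A.traceβ (A.opH L) = A.traceβ L := by
  rw [traceβ, traceβ]
  congr 1
  ext x y; simp [opH, hEnd_hEnd]

theorem traceα_g : A.traceα A.g = 2 * n := by
  rw [traceα, A.metricTrace_eq_trace _ A.hEnd, trace_hEnd]
  intro x y
  simp [opH, g_hEnd_left, hEnd_hEnd]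

/-- The second φ turns the fundamental form into -hg. This is the source of the minus sign in the
factor of `component 4`. -/
theorem traceβ_fundamental : A.traceβ ((A.opH A.g).compl₂ A.φ) = -(2 * n) := by
  rw [traceβ, A.metricTrace_eq_trace _ (-A.hEnd), map_neg, trace_hEnd]
  intro x y
  simp [opH, g_hEnd_left, hEnd_hEnd, hEnd_φ, φ_φ]

theorem traceα_component_one (L : V →ₗ[ℝ] V →ₗ[ℝ] ℝ) :
    A.traceα L / (2 * n) * A.traceα (A.opH A.g) / (2 * n) = A.traceα L / (2 * n) := by
  rw [traceα_opH, traceα_g]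
  -- For n = 0, division by zero gives 0 on both sides, matching the convention L₁ = 0.
  rcases eq_or_ne (n : ℝ) 0 with h | h
  · simp [h]
  · field_simp

theorem traceβ_component_four (L : V →ₗ[ℝ] V →ₗ[ℝ] ℝ) :
    -(-A.traceβ L / (2 * n) * A.traceβ ((A.opH A.g).compl₂ A.φ)) / (2 * n)
      = -A.traceβ L / (2 * n) := by
  rw [traceβ_fundamental]
  rcases eq_or_ne (n : ℝ) 0 with h | h
  · simp [h]
  · field_simp

theorem traceα_opS_opH (L : V →ₗ[ℝ] V →ₗ[ℝ] ℝ) :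
    A.traceα (opS (A.opH L)) = A.traceα L := by
  rw [opS, traceα_smul, traceα_add, traceα_flip, traceα_opH]; ring

theorem traceβ_opA_opH (L : V →ₗ[ℝ] V →ₗ[ℝ] ℝ) :
    A.traceβ (opA (A.opH L)) = A.traceβ L := by
  rw [opA, traceβ_smul, traceβ_sub, traceβ_flip,
    traceβ_opH]
  ring

/-- `L_2(L)` is trace-free. -/
theorem traceα_component_two (L : V →ₗ[ℝ] V →ₗ[ℝ] ℝ) :
    A.traceα (A.component 2 L) / (2 * n) = 0 := by
  rw [component, traceα_sub, traceα_smul, traceα_smul, traceα_add,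
    traceα_opPhi, traceα_opS_opH]
  linear_combination -A.traceα_component_one L

theorem traceβ_component_five (L : V →ₗ[ℝ] V →ₗ[ℝ] ℝ) :
    A.traceβ (A.component 5 L) / (2 * n) = 0 := by
  rw [component, traceβ_sub, traceβ_smul, traceβ_smul, traceβ_add,
    traceβ_opPhi, traceβ_opA_opH]
  linear_combination A.traceβ_component_four L

/-! ### Idempotence of the nine components -/

theorem g_hEnd_right_comm (x y : V) : A.g y (A.hEnd x) = A.g x (A.hEnd y) := by
  rw [A.g_symm, g_hEnd_left]

theorem g_hEnd_φ (x y : V) : A.g (A.hEnd x) (A.φ y) = A.g x (A.φ y) := by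
  rw [g_hEnd_left, hEnd_φ]

theorem g_φ_φ (x y : V) : A.g (A.φ x) (A.φ y) = A.g x (A.hEnd y) := by
  rw [g_φ_left, φ_φ, map_neg, neg_neg]

theorem g_φ_right_comm (x y : V) : A.g y (A.φ x) = -A.g x (A.φ y) := by
  rw [A.g_symm, g_φ_left]

theorem component_one_component_one (L : V →ₗ[ℝ] V →ₗ[ℝ] ℝ) :
    A.component 1 (A.component 1 L) = A.component 1 L := by
  simp only [component, traceα_smul]
  rw [A.traceα_component_one]

/-- The trace correction of the outer map vanishes because L₂(L) is trace-free. What remains is the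
average over L ↦ L∘φ, an involution on tensors of the form hL, and it fixes both ShL + ShL∘φ and hg.
-/
theorem component_two_component_two (L : V →ₗ[ℝ] V →ₗ[ℝ] ℝ) :
    A.component 2 (A.component 2 L) = A.component 2 L := by
  conv_lhs => rw [component, traceα_component_two, component]
  rw [component]
  ext x y
  simp [opS, opH, opPhi, φ_φ, hEnd_φ, φ_hEnd, hEnd_hEnd, g_hEnd_hEnd, g_φ_φ]
  linear_combination (-(A.traceα L / (2 * n)) / 2) * A.g_hEnd_right_comm x y

theorem component_three_component_three (L : V →ₗ[ℝ] V →ₗ[ℝ] ℝ) :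
    A.component 3 (A.component 3 L) = A.component 3 L := by
  simp only [component]
  ext x y
  simp [opS, opH, opPhi, φ_φ, hEnd_φ, φ_hEnd, hEnd_hEnd]
  ring

theorem component_four_component_four (L : V →ₗ[ℝ] V →ₗ[ℝ] ℝ) :
    A.component 4 (A.component 4 L) = A.component 4 L := by
  simp only [component, traceβ_smul]
  rw [A.traceβ_component_four]

/-- The skew counterpart: L₅(L) has zero β-trace, and the fundamental form is itself skew and
φ-invariant. -/
theorem component_five_component_five (L : V →ₗ[ℝ] V →ₗ[ℝ] ℝ) :
    A.component 5 (A.component 5 L) = A.component 5 L := by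
  conv_lhs => rw [component, neg_div, traceβ_component_five, component]
  rw [component]
  ext x y
  simp [opA, opH, opPhi, φ_φ, hEnd_φ, φ_hEnd, hEnd_hEnd, g_hEnd_φ, g_φ_left]
  linear_combination (-(A.traceβ L / (2 * n)) / 2) * A.g_φ_right_comm x y

theorem component_six_component_six (L : V →ₗ[ℝ] V →ₗ[ℝ] ℝ) :
    A.component 6 (A.component 6 L) = A.component 6 L := by
  simp only [component]
  ext x y
  simp [opA, opH, opPhi, φ_φ, hEnd_φ, φ_hEnd, hEnd_hEnd]
  ring

theorem component_seven_component_seven (L : V →ₗ[ℝ] V →ₗ[ℝ] ℝ) :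
    A.component 7 (A.component 7 L) = A.component 7 L := by
  simp only [component]
  ext x y
  simp [opS, opV, η_ξ]
  ring

theorem component_eight_component_eight (L : V →ₗ[ℝ] V →ₗ[ℝ] ℝ) :
    A.component 8 (A.component 8 L) = A.component 8 L := by
  simp only [component]
  ext x y
  simp [opA, opV, η_ξ]
  ring

theorem component_nine_component_nine (L : V →ₗ[ℝ] V →ₗ[ℝ] ℝ) :
    A.component 9 (A.component 9 L) = A.component 9 L := by
  simp only [component]
  ext x y
  simp [opW, η_ξ]

/-! ### Decomposition of symmetric and of skew tensors -/

/-- The terms with α cancel between the first two components and those with L∘φ against the third,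
leaving ShL + SvL + wL = SL. -/
theorem sum_component_of_symm {L : V →ₗ[ℝ] V →ₗ[ℝ] ℝ} (hL : ∀ x y, L x y = L y x) :
    A.component 1 L + A.component 2 L + A.component 3 L + A.component 7 L + A.component 9 L
      = L := by
  simp only [component]
  ext x y
  simp [opS, opH, opV, opW, opPhi, hEnd_apply]
  linear_combination (-1 / 2 : ℝ) * hL x y

/-- The same cancellation leaves AhL + AvL, which is AL because A kills wL. -/
theorem sum_component_of_skew {L : V →ₗ[ℝ] V →ₗ[ℝ] ℝ} (hL : ∀ x y, L x y = -L y x) :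
    A.component 4 L + A.component 5 L + A.component 6 L + A.component 8 L = L := by
  simp only [component]
  ext x y
  simp [opA, opH, opV, opPhi, hEnd_apply]
  linear_combination (-1 / 2 : ℝ) * hL x y

/-- `L_1 ⊕ L_2 ⊕ L_3 ⊕ L_7 ⊕ L_9` consists of the symmetric tensors. -/
theorem mem_iSup_subspace_iff_symm {L : V →ₗ[ℝ] V →ₗ[ℝ] ℝ} :
    L ∈ ⨆ i ∈ ({1, 2, 3, 7, 9} : Finset ℕ), A.subspace i ↔ ∀ x y, L x y = L y x := by
  constructor
  -- Symmetric tensors form a subspace, the fixed points of the flip, so each summand can be checked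
  -- separately.
  · have h : ⨆ i ∈ ({1, 2, 3, 7, 9} : Finset ℕ), A.subspace i
        ≤ LinearMap.eqLocus LinearMap.id (LinearMap.lflip : _ ≃ₗ[ℝ] _).toLinearMap := by
      refine iSup₂_le fun i hi K (hK : K = A.component i K) => ?_
      change K = K.flip
      ext x y
      simp only [Finset.mem_insert, Finset.mem_singleton] at hi
      rw [LinearMap.flip_apply, hK]
      rcases hi with rfl | rfl | rfl | rfl | rfl
      · simp [component, opH, g_hEnd_hEnd, A.g_hEnd_right_comm x y]
      · simp [component, opS, opPhi, opH, g_hEnd_hEnd, A.g_hEnd_right_comm x y]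
        ring
      · simp [component, opS, opPhi, opH]
        ring
      · simp [component, opS, opV]
        ring
      · simp [component, opW, mul_comm (A.η x)]
    intro hL x y
    exact congr($(h hL) x y)
  · intro hL
    have hsub (i : ℕ) (hi : i ∈ ({1, 2, 3, 7, 9} : Finset ℕ)) :
        A.subspace i ≤ ⨆ i ∈ ({1, 2, 3, 7, 9} : Finset ℕ), A.subspace i :=
      le_iSup₂_of_le i hi le_rfl
    -- Idempotence puts the i-th summand into the i-th subspace.
    rw [← A.sum_component_of_symm hL]
    exact add_mem (add_mem (add_mem (add_mem
      (hsub 1 (by simp) (A.component_one_component_one L).symm)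
      (hsub 2 (by simp) (A.component_two_component_two L).symm))
      (hsub 3 (by simp) (A.component_three_component_three L).symm))
      (hsub 7 (by simp) (A.component_seven_component_seven L).symm))
      (hsub 9 (by simp) (A.component_nine_component_nine L).symm)

/-- `L_4 ⊕ L_5 ⊕ L_6 ⊕ L_8` consists of the antisymmetric tensors. -/
theorem mem_iSup_subspace_iff_skew {L : V →ₗ[ℝ] V →ₗ[ℝ] ℝ} :
    L ∈ ⨆ i ∈ ({4, 5, 6, 8} : Finset ℕ), A.subspace i ↔ ∀ x y, L x y = -L y x := by
  constructor
  · have h : ⨆ i ∈ ({4, 5, 6, 8} : Finset ℕ), A.subspace i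
        ≤ LinearMap.eqLocus LinearMap.id ((-1 : ℝ) • (LinearMap.lflip : _ ≃ₗ[ℝ] _).toLinearMap) := by
      refine iSup₂_le fun i hi K (hK : K = A.component i K) => ?_
      change K = (-1 : ℝ) • K.flip
      ext x y
      simp only [Finset.mem_insert, Finset.mem_singleton] at hi
      rw [LinearMap.smul_apply, LinearMap.smul_apply, LinearMap.flip_apply, hK]
      rcases hi with rfl | rfl | rfl | rfl
      · simp [component, opH, g_hEnd_φ, hEnd_φ, A.g_φ_right_comm x y]
      · simp [component, opA, opPhi, opH, g_hEnd_φ, hEnd_φ, A.g_φ_right_comm x y]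
        ring
      · simp [component, opA, opPhi, opH]
        ring
      · simp [component, opA, opV]
        ring
    intro hL x y
    simpa using congr($(h hL) x y)
  · intro hL
    have hsub (i : ℕ) (hi : i ∈ ({4, 5, 6, 8} : Finset ℕ)) :
        A.subspace i ≤ ⨆ i ∈ ({4, 5, 6, 8} : Finset ℕ), A.subspace i :=
      le_iSup₂_of_le i hi le_rfl
    rw [← A.sum_component_of_skew hL]
    exact add_mem (add_mem (add_mem
      (hsub 4 (by simp) (A.component_four_component_four L).symm)
      (hsub 5 (by simp) (A.component_five_component_five L).symm))
      (hsub 6 (by simp) (A.component_six_component_six L).symm))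
      (hsub 8 (by simp) (A.component_eight_component_eight L).symm)

end AlmostContactMetricSpace

/-! ### Differentiability of the dual vector field -/

section Dual

variable {m : ℕ} {M : Type*} [TopologicalSpace M] [ChartedSpace (EuclideanSpace ℝ (Fin m)) M]

theorem mdifferentiableAt_det {ι : Type} [Fintype ι] [DecidableEq ι]
    {G : M → Matrix ι ι ℝ} {p : M}
    (hG : ∀ i j, MDifferentiableAt (𝓡 m) 𝓘(ℝ, ℝ) (fun q => G q i j) p) :
    MDifferentiableAt (𝓡 m) 𝓘(ℝ, ℝ) (fun q => (G q).det) p := by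
  have h : (fun q => (G q).det) = ∑ σ : Equiv.Perm ι,
      ((Equiv.Perm.sign σ : ℤ) : ℝ) • ∏ i, fun q => G q (σ i) i := by
    ext q
    simp [Matrix.det_apply']
  rw [h]
  exact MDifferentiableAt.sum fun (σ : Equiv.Perm ι) _ =>
    (MDifferentiableAt.prod fun i _ => hG (σ i) i).const_smul _

/-- By Cramer's rule, the solution of a linear system depends differentiably on the system. -/
theorem mdifferentiableAt_of_mulVec_eq {ι : Type} [Fintype ι] [DecidableEq ι]
    {G : M → Matrix ι ι ℝ} {a c : M → ι → ℝ} {p : M}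
    (hG : ∀ i j, MDifferentiableAt (𝓡 m) 𝓘(ℝ, ℝ) (fun q => G q i j) p)
    (ha : ∀ i, MDifferentiableAt (𝓡 m) 𝓘(ℝ, ℝ) (fun q => a q i) p)
    (hdet : (G p).det ≠ 0) (h : ∀ᶠ q in nhds p, (G q).mulVec (c q) = a q) (i : ι) :
    MDifferentiableAt (𝓡 m) 𝓘(ℝ, ℝ) (fun q => c q i) p := by
  have hD := mdifferentiableAt_det hG
  have hN : MDifferentiableAt (𝓡 m) 𝓘(ℝ, ℝ) (fun q => ((G q).updateCol i (a q)).det) p := by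
    refine mdifferentiableAt_det fun k j => ?_
    rcases eq_or_ne j i with rfl | hj
    · simpa using ha k
    · simpa [hj] using hG k j
  -- The determinant stays nonzero near p by continuity, so Cramer's quotient equals the coefficient
  -- there.
  refine (hN.div hD hdet).congr_of_eventuallyEq ?_
  filter_upwards [h, hD.continuousAt.eventually_ne hdet] with q hq hq'
  rw [Pi.div_apply, eq_div_iff hq', ← Matrix.cramer_apply, ← hq, Matrix.cramer_eq_adjugate_mulVec,
    Matrix.mulVec_mulVec, Matrix.adjugate_mul, Matrix.smul_mulVec, Matrix.one_mulVec, Pi.smul_apply,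
    smul_eq_mul, mul_comm]

variable [IsManifold (𝓡 m) ∞ M]

/-- The Gram matrix of a linearly independent family is nonsingular. -/
theorem SmoothMetric.det_gram_ne_zero (g : SmoothMetric m M) {p : M} {ι : Type*} [Fintype ι]
    [DecidableEq ι] {s : ι → TangentSpace (𝓡 m) p} (hs : LinearIndependent ℝ s) :
    (Matrix.of fun i j => g.inner p (s i) (s j)).det ≠ 0 := by
  intro h
  obtain ⟨v, hv, hGv⟩ := Matrix.exists_mulVec_eq_zero_iff.2 h
  refine hv (funext (Fintype.linearIndependent_iff.1 hs v ?_))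
  -- A kernel vector v gives w = ∑ vⱼsⱼ orthogonal to every sᵢ, hence to itself, which contradicts
  -- positivity unless w = 0.
  by_contra hw
  refine (g.pos p _ hw).ne' ?_
  have hi (i : ι) : g.inner p (s i) (∑ j, v j • s j) = 0 := by
    rw [map_sum]
    refine Eq.trans ?_ (congrFun hGv i)
    rw [Matrix.mulVec, dotProduct]
    refine Finset.sum_congr rfl fun j _ => ?_
    rw [map_smul, smul_eq_mul, mul_comm]
    rfl
  rw [g.symm, map_sum]
  refine Finset.sum_eq_zero fun i _ => ?_
  rw [map_smul, g.symm, hi, smul_zero]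

theorem OneForm.inner_dual (θ : OneForm m M) (g : SmoothMetric m M) (p : M)
    (w : TangentSpace (𝓡 m) p) : g.inner p (θ.dual g p) w = θ.toFun p w :=
  g.inner_flat_symm p _ w

/-- The field θ* is defined by inverting the metric pointwise, while the connection formulas require
differentiable fields. In a local frame its coefficients solve the system with the Gram matrix g(sᵢ,
sⱼ) and right-hand side θ(sᵢ), so Cramer's rule applies. -/
theorem OneForm.vDiffAt_dual (θ : OneForm m M) (g : SmoothMetric m M) (p : M) :
    VDiffAt (θ.dual g) p := by
  let t := trivializationAt (EuclideanSpace ℝ (Fin m)) (fun q : M => TangentSpace (𝓡 m) q) p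
  let b := (EuclideanSpace.basisFun (Fin m) ℝ).toBasis
  have hp : p ∈ t.baseSet := FiberBundle.mem_baseSet_trivializationAt' p
  have hs (i : Fin m) : VDiffAt (t.localFrame b i) p :=
    (contMDiffAt_localFrame_of_mem 1 t b i hp).mdifferentiableAt (by simp)
  rw [VDiffAt, mdifferentiableAt_iff_localFrameCoeff b hp]
  refine mdifferentiableAt_of_mulVec_eq
    (c := fun q i => t.localFrameCoeff (𝓡 m) b i q (θ.dual g q))
    (fun i j => g.mdiffAt (hs i) (hs j)) (fun i => θ.mdiffAt (hs i))
    (g.det_gram_ne_zero ((t.isLocalFrameOn_localFrame_baseSet (𝓡 m) 1 b).linearIndependent hp)) ?_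
  filter_upwards [t.eventually_eq_localFrame_sum_coeff_smul (I := 𝓡 m) b (s := θ.dual g) hp]
    with q hq
  ext i
  rw [← θ.inner_dual g, g.symm]
  conv_rhs => rw [hq]
  rw [map_sum]
  change ∑ j, g.inner q (t.localFrame b i q) (t.localFrame b j q)
    * t.localFrameCoeff (𝓡 m) b j q (θ.dual g q) = _
  refine Finset.sum_congr rfl fun j _ => ?_
  rw [map_smul, smul_eq_mul, mul_comm]

/-! ### Closed forms and Killing fields in terms of ∇θ -/

/-- Closedness and the Killing condition are tested on fields smooth near p; such extensions carry
them over to identities between tensors at p. -/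
theorem exists_vSmoothAt_vectorField (p : M) (v : TangentSpace (𝓡 m) p) :
    ∃ X : ∀ q : M, TangentSpace (𝓡 m) q, VSmoothAt X p ∧ X p = v :=
  ⟨FiberBundle.extend (EuclideanSpace ℝ (Fin m)) v,
    FiberBundle.contMDiffAt_extend (I := 𝓡 m) (k := ∞) .., by simp⟩

theorem VSmoothAt.vDiffAt {X : ∀ q : M, TangentSpace (𝓡 m) q} {p : M} (hX : VSmoothAt X p) :
    VDiffAt X p :=
  ContMDiffAt.mdifferentiableAt hX (by simp)

theorem SmoothMetric.leviCivita_sub_leviCivita (g : SmoothMetric m M)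
    {X Y : ∀ q : M, TangentSpace (𝓡 m) q} {p : M} (hX : VDiffAt X p) (hY : VDiffAt Y p) :
    g.leviCivita Y p (X p) - g.leviCivita X p (Y p) = VectorField.mlieBracket (𝓡 m) X Y p :=
  (CovariantDerivative.torsion_eq_zero_iff _).1 g.leviCivita_torsion hX hY

/-- `dθ` is twice the antisymmetrization of `∇θ`. -/
theorem OneForm.nabla_sub_nabla (θ : OneForm m M) (g : SmoothMetric m M)
    {X Y : ∀ q : M, TangentSpace (𝓡 m) q} {p : M} (hX : VDiffAt X p) (hY : VDiffAt Y p) :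
    θ.nabla g p (X p) (Y p) - θ.nabla g p (Y p) (X p)
      = mvfderiv (𝓡 m) (fun q => θ.toFun q (Y q)) p (X p)
        - mvfderiv (𝓡 m) (fun q => θ.toFun q (X q)) p (Y p)
        - θ.toFun p (VectorField.mlieBracket (𝓡 m) X Y p) := by
  rw [θ.nabla_apply g hX hY, θ.nabla_apply g hY hX, ← g.leviCivita_sub_leviCivita hX hY, map_sub]
  ring

/-- Differentiate g(θ*, Y) = θ(Y) along X and use metric compatibility. -/
theorem OneForm.inner_leviCivita_dual (θ : OneForm m M) (g : SmoothMetric m M)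
    {X Y : ∀ q : M, TangentSpace (𝓡 m) q} {p : M} (hX : VDiffAt X p) (hY : VDiffAt Y p) :
    g.inner p (g.leviCivita (θ.dual g) p (X p)) (Y p) = θ.nabla g p (X p) (Y p) := by
  have h := g.leviCivita_metric hX (θ.vDiffAt_dual g p) hY
  simp only [θ.inner_dual] at h
  rw [θ.nabla_apply g hX hY, h]
  ring

/-- The Lie derivative of `g` along `θ*` is twice the symmetrization of `∇θ`. -/
theorem OneForm.nabla_add_nabla (θ : OneForm m M) (g : SmoothMetric m M)
    {Y Z : ∀ q : M, TangentSpace (𝓡 m) q} {p : M} (hY : VDiffAt Y p) (hZ : VDiffAt Z p) :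
    θ.nabla g p (Y p) (Z p) + θ.nabla g p (Z p) (Y p)
      = mvfderiv (𝓡 m) (fun q => g.inner q (Y q) (Z q)) p (θ.dual g p)
        - g.inner p (VectorField.mlieBracket (𝓡 m) (θ.dual g) Y p) (Z p)
        - g.inner p (Y p) (VectorField.mlieBracket (𝓡 m) (θ.dual g) Z p) := by
  have hX := θ.vDiffAt_dual g p
  -- The derivatives of Y and Z along θ* cancel, leaving g(∇_Y θ*, Z) + g(Y, ∇_Z θ*).
  rw [g.leviCivita_metric hX hY hZ, ← g.leviCivita_sub_leviCivita hX hY,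
    ← g.leviCivita_sub_leviCivita hX hZ, map_sub, map_sub, _root_.sub_apply,
    g.symm p (Y p) (g.leviCivita (θ.dual g) p (Z p)), θ.inner_leviCivita_dual g hY hZ,
    θ.inner_leviCivita_dual g hZ hY]
  ring

theorem OneForm.isClosed_iff (θ : OneForm m M) (g : SmoothMetric m M) :
    θ.IsClosed ↔ ∀ p x y, θ.nabla g p x y = θ.nabla g p y x := by
  constructor
  · intro h p x y
    obtain ⟨X, hX, rfl⟩ := exists_vSmoothAt_vectorField p x
    obtain ⟨Y, hY, rfl⟩ := exists_vSmoothAt_vectorField p y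
    rw [← sub_eq_zero, θ.nabla_sub_nabla g hX.vDiffAt hY.vDiffAt]
    exact h p X Y hX hY
  · intro h p X Y hX hY
    rw [← θ.nabla_sub_nabla g hX.vDiffAt hY.vDiffAt, h, sub_self]

theorem OneForm.isKilling_dual_iff (θ : OneForm m M) (g : SmoothMetric m M) :
    g.IsKilling (θ.dual g) ↔ ∀ p x y, θ.nabla g p x y = -θ.nabla g p y x := by
  constructor
  · intro h p x y
    obtain ⟨X, hX, rfl⟩ := exists_vSmoothAt_vectorField p x
    obtain ⟨Y, hY, rfl⟩ := exists_vSmoothAt_vectorField p y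
    rw [eq_neg_iff_add_eq_zero, θ.nabla_add_nabla g hX.vDiffAt hY.vDiffAt]
    exact h p X Y hX hY
  · intro h p X Y hX hY
    rw [← θ.nabla_add_nabla g hX.vDiffAt hY.vDiffAt, h, neg_add_cancel]

end Dual

theorem proposition2 (n : ℕ) {M : Type*} [TopologicalSpace M]
    [ChartedSpace (EuclideanSpace ℝ (Fin (2 * n + 1))) M] [IsManifold (𝓡 (2 * n + 1)) ∞ M]
    (S : AlmostContactMetricStructure n M) (θ : OneForm (2 * n + 1) M) :
    (θ.IsClosed ↔ θ ∈ S.OmegaSum {1, 2, 3, 7, 9}) ∧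
      (S.g.IsKilling (θ.dual S.g) ↔ θ ∈ S.OmegaSum {4, 5, 6, 8}) := by
  refine ⟨(θ.isClosed_iff S.g).trans (forall_congr' fun p => ?_),
    (θ.isKilling_dual_iff S.g).trans (forall_congr' fun p => ?_)⟩
  · exact (S.tangent p).mem_iSup_subspace_iff_symm.symm
  · exact (S.tangent p).mem_iSup_subspace_iff_skew.symm
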